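/- Let $G$ be a compact (Hausdorff) group with normalized Haar measure $\lambda_G$ ($\lambda_G(G)=1$), $N$ a closed normal subgroup of $G$ with normalized Haar measure $\lambda_N$ ($\lambda_N(N)=1$), and $\lambda_{G/N}$ the Haar measure of $G/N$ given by Weil's formula $\int_{G/N}\int_N f(xs)\,d\lambda_N(s)\,d\lambda_{G/N}(xN)=\int_G f\,d\lambda_G$ for $f\in\mathcal C(G)$. Let $\xi:N\to\mathbb T$ be a continuous homomorphism that is $G$-invariant, i.e. $\xi(x^{-1}sx)=\xi(s)$ for all $x\in G$, $s\in N$ (in symbols, $\xi\in\Gamma(G,N)$), and let $1<p<\infty$. Let $\mathcal C_\xi(G,N)$ be the space of continuous functions $\psi:G\to\mathbb C$ with $\psi(xs)=\xi(s)\psi(x)$ for all $x\in G$, $s\in N$, with the norm $\|\psi\|_{(p)}=\bigl(\int_{G/N}|\psi(y)|^p\,d\lambda_{G/N}(yN)\bigr)^{1/p}$. Then $\|\psi\|_{(p)}=\|\psi\|_{L^p(G)}$ for $\psi\in\mathcal C_\xi(G,N)$, so the completion $L^p_\xi(G,N)$ of $\mathcal C_\xi(G,N)$ is its closure in $L^p(G)$.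 For $f,g\in L^p(G)$ the convolution $f*g(x)=\int_G f(y)g(y^{-1}x)\,d\lambda_G(y)$ exists for almost every $x$ and lies in $L^p(G)$, and so does $f^*(x)=\Delta_G(x^{-1})\overline{f(x^{-1})}$, where $\Delta_G$ is the modular function (here $\Delta_G=1$). With these operations and the $L^p(G)$-norm, $L^p(G)$ is a Banach $*$-algebra (complete, with associative bilinear submultiplicative product and isometric conjugate-linear antimultiplicative involution). Moreover: 1. $L^p_\xi(G,N)$ is closed under $*$ and $f\mapsto f^*$, and with these operations and the $L^p(G)$-norm it is a Banach $*$-algebra. 2. The operator $T_\xi:\mathcal C(G)\to\mathcal C_\xi(G,N)$, $T_\xi f(x)=\int_N f(xs)\overline{\xi(s)}\,d\lambda_N(s)$, has a unique continuous linear extension $T_\xi:L^p(G)\to L^p_\xi(G,N)$, and this extension is a contraction and a $*$-homomorphism: $\|T_\xi f\|\le\|f\|$, $T_\xi(f*g)=T_\xi f*T_\xi g$, $T_\xi(f^*)=(T_\xi f)^*$. 3. The kernel $\mathcal N^p_\xi(G,N)$ of $T_\xi$ in $L^p(G)$ is a closed two-sided $*$-ideal of $L^p(G)$. 4. The quotient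 $L^p(G)/\mathcal N^p_\xi(G,N)$, with the quotient norm and the induced product and involution, is a Banach $*$-algebra, and $f+\mathcal N^p_\xi(G,N)\mapsto T_\xi f$ is an isometric $*$-isomorphism of it onto $L^p_\xi(G,N)$. -/

import Mathlib

open MeasureTheory
open scoped ENNReal

noncomputable section

namespace CovariantLp

/-! ### Banach `*`-algebras -/

/-- A (complex, not necessarily unital) Banach `*`-algebra structure on a normed space `A`, with
product `mul` and isometric involution `star`. Definiteness of the norm is spelled out in the
first field, because the norm of a quotient by a closed subspace comes as a seminorm. -/
structure IsBanachStarAlgebra {A : Type*} [SeminormedAddCommGroup A] [NormedSpace ℂ A]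
    (mul : A → A → A) (star : A → A) : Prop where
  eq_zero_of_norm_eq_zero : ∀ a : A, ‖a‖ = 0 → a = 0
  complete : CompleteSpace A
  mul_add : ∀ a b c, mul a (b + c) = mul a b + mul a c
  add_mul : ∀ a b c, mul (a + b) c = mul a c + mul b c
  smul_mul : ∀ (z : ℂ) (a b : A), mul (z • a) b = z • mul a b
  mul_smul : ∀ (z : ℂ) (a b : A), mul a (z • b) = z • mul a b
  mul_assoc : ∀ a b c, mul (mul a b) c = mul a (mul b c)
  norm_mul_le : ∀ a b, ‖mul a b‖ ≤ ‖a‖ * ‖b‖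
  star_add : ∀ a b, star (a + b) = star a + star b
  star_smul : ∀ (z : ℂ) (a : A), star (z • a) = (starRingEnd ℂ) z • star a
  star_star : ∀ a, star (star a) = a
  star_mul : ∀ a b, star (mul a b) = mul (star b) (star a)
  norm_star : ∀ a, ‖star a‖ = ‖a‖

/-- `I` is a closed two-sided ideal for `mul`, stable under `star`. -/
structure IsClosedStarIdeal {A : Type*} [SeminormedAddCommGroup A] [NormedSpace ℂ A]
    (mul : A → A → A) (star : A → A) (I : Submodule ℂ A) : Prop where
  isClosed : IsClosed (I : Set A)
  mul_mem_left : ∀ a b, b ∈ I → mul a b ∈ I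
  mul_mem_right : ∀ a b, a ∈ I → mul a b ∈ I
  star_mem : ∀ a, a ∈ I → star a ∈ I

section Convolution

variable {G : Type*} [Group G] [TopologicalSpace G] [IsTopologicalGroup G] [CompactSpace G]
  [MeasurableSpace G]

/-- Convolution `(f * g)(x) = ∫ f(y) g(y⁻¹ x) dy` of functions on `G`. -/
def conv (μ : Measure G) (f g : G → ℂ) : G → ℂ :=
  fun x => ∫ y, f y * g (y⁻¹ * x) ∂μ

/-- The involution `f^*(x) = Δ(x⁻¹) \overline{f(x⁻¹)}` of functions on `G`, where
`Δ(x) = λ(E x) / λ(E)`. Mathlib's `modularCharacterFun` is `x ↦ λ(E x⁻¹) / λ(E) = Δ(x⁻¹)`. -/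
def invol (f : G → ℂ) : G → ℂ :=
  fun x => ((Measure.modularCharacterFun x : ℝ) : ℂ) * (starRingEnd ℂ) (f x⁻¹)

variable {p : ℝ≥0∞} {μ : Measure G}

open Classical in
/-- The element of `L^p` represented by `f`, with the value `0` if `f` is not in `L^p`. -/
def ofFun (p : ℝ≥0∞) (μ : Measure G) (f : G → ℂ) : Lp ℂ p μ :=
  if h : MemLp f p μ then h.toLp f else 0

/-- Convolution on `L^p(G)`. -/
def convLp (f g : Lp ℂ p μ) : Lp ℂ p μ := ofFun p μ (conv μ f g)

/-- Involution on `L^p(G)`. -/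
def involLp (f : Lp ℂ p μ) : Lp ℂ p μ := ofFun p μ (invol f)

end Convolution

section Covariant

variable {G : Type*} [Group G] [TopologicalSpace G] [IsTopologicalGroup G]

/-- `Γ(G,N)`: the characters `ξ : N → 𝕋` (continuous homomorphisms) that are `G`-invariant,
`ξ(x⁻¹ s x) = ξ(s)` for all `x ∈ G`, `s ∈ N`. -/
def invariantCharacters (N : Subgroup G) [hN : N.Normal] : Set (N →ₜ* Circle) :=
  {ξ | ∀ (x : G) (s : N),
    ξ ⟨x⁻¹ * s * x, by simpa using hN.conj_mem s s.2 x⁻¹⟩ = ξ s}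

variable [CompactSpace G] (N : Subgroup G) (ξ : N →ₜ* Circle)

/-- `𝒞_ξ(G,N)`: the continuous functions `ψ` on `G` with `ψ(xs) = ξ(s) ψ(x)` whose support has
compact image in `G/N`. -/
def covariantSubmodule : Submodule ℂ C(G, ℂ) where
  carrier := {ψ | IsCompact ((QuotientGroup.mk : G → G ⧸ N) '' tsupport ψ) ∧
    ∀ (x : G) (s : N), ψ (x * s) = (ξ s : ℂ) * ψ x}
  add_mem' := by
    rintro a b ⟨-, ha⟩ ⟨-, hb⟩
    refine ⟨(isClosed_tsupport _).isCompact.image continuous_quotient_mk', fun x s => ?_⟩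
    simp [ha, hb, mul_add]
  zero_mem' :=
    ⟨(isClosed_tsupport _).isCompact.image continuous_quotient_mk', fun x s => by simp⟩
  smul_mem' := by
    rintro c a ⟨-, ha⟩
    refine ⟨(isClosed_tsupport _).isCompact.image continuous_quotient_mk', fun x s => ?_⟩
    simp [ha, mul_left_comm]

/-- `|ψ|^p` as a function on `G/N`, for a covariant function `ψ`. -/
def absPowQuot (p : ℝ) (ψ : covariantSubmodule N ξ) : G ⧸ N → ℝ :=
  Quotient.lift (fun x : G => ‖(ψ : C(G, ℂ)) x‖ ^ p) (by
    intro a b hab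
    have h : a⁻¹ * b ∈ N := QuotientGroup.leftRel_apply.mp hab
    have := ψ.2.2 a ⟨a⁻¹ * b, h⟩
    simp only [mul_inv_cancel_left] at this
    have hb : ‖(ψ : C(G, ℂ)) b‖ = ‖(ψ : C(G, ℂ)) a‖ := by
      rw [this, norm_mul, Circle.norm_coe, one_mul]
    simp only [hb])

variable [MeasurableSpace G] [BorelSpace G]

/-- `‖ψ‖_(p) = (∫_{G/N} |ψ(y)|^p dν(yN))^{1/p}`. -/
def covariantNorm [MeasurableSpace (G ⧸ N)] (ν : Measure (G ⧸ N)) (p : ℝ)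
    (ψ : covariantSubmodule N ξ) : ℝ :=
  (∫ z, absPowQuot N ξ p ψ z ∂ν) ^ (1 / p)

/-- `T_N f (xN) = ∫_N f(xs) ds`. -/
def averageQuot (lN : Measure N) [lN.IsMulLeftInvariant] (f : C(G, ℂ)) : G ⧸ N → ℂ :=
  Quotient.lift (fun x : G => ∫ s : N, f (x * s) ∂lN) (by
    intro a b hab
    have h : a⁻¹ * b ∈ N := QuotientGroup.leftRel_apply.mp hab
    have := integral_mul_left_eq_self (μ := lN) (fun s : N => f (a * s)) ⟨a⁻¹ * b, h⟩
    simpa [mul_assoc] using this.symm)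

/-- Weil's formula `∫_{G/N} T_N f dν = ∫_G f dμ`, for `f` continuous (`G` is compact); it
expresses that the measure `ν` on `G/N` is normalized with respect to those on `G` and `N`. -/
def WeilFormula (μ : Measure G) (lN : Measure N) [lN.IsMulLeftInvariant]
    [MeasurableSpace (G ⧸ N)] (ν : Measure (G ⧸ N)) : Prop :=
  ∀ f : C(G, ℂ), ∫ z, averageQuot N lN f z ∂ν = ∫ x, f x ∂μ

/-- `T_ξ f (x) = ∫_N f(xs) \overline{ξ(s)} ds`. -/
def covariantAverage (lN : Measure N) (f : G → ℂ) : G → ℂ :=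
  fun x => ∫ s : N, f (x * s) * (starRingEnd ℂ) (ξ s : ℂ) ∂lN

variable (p : ℝ≥0∞) [Fact (1 ≤ p)] (μ : Measure G) [IsFiniteMeasure μ]

/-- `L^p_ξ(G,N)`: the closure, that is the completion, of `𝒞_ξ(G,N)` in `L^p(G)`. -/
def covariantLp : Submodule ℂ (Lp ℂ p μ) :=
  ((covariantSubmodule N ξ).map
    (ContinuousMap.toLp (E := ℂ) p μ ℂ).toLinearMap).topologicalClosure

/-- `T : L^p(G) → L^p_ξ(G,N)` is a continuous linear extension of
`T_ξ : 𝒞(G) → 𝒞_ξ(G,N)`. -/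
def ExtendsCovariantAverage (lN : Measure N) (T : Lp ℂ p μ →L[ℂ] covariantLp N ξ p μ) : Prop :=
  ∀ f : C(G, ℂ), ∃ ψ ∈ covariantSubmodule N ξ, (ψ : G → ℂ) = covariantAverage N ξ lN f ∧
    (T (ContinuousMap.toLp (E := ℂ) p μ ℂ f) : Lp ℂ p μ) = ContinuousMap.toLp (E := ℂ) p μ ℂ ψ

end Covariant

end CovariantLp

end

/-! Every algebraic identity is an identity between integrals of continuous functions on compact
spaces, and passes to `L^p` because `C(G)` is dense there (`p ≠ ∞`) and all operations are
continuous.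

Continuity of convolution is the analytic core. For continuous functions, `f * g` is the average of
the left translates of `g` with weight `f`, so `‖f * g‖_p ≤ ‖f‖_1 ‖g‖_p ≤ ‖f‖_p ‖g‖_p`, as `G` has
mass 1. `G` need not be second countable, so Tonelli on `G × G` is avoided for general `L^p`
functions: `f` and `g` are expanded into absolutely convergent series of continuous functions, and
`f * g` is almost everywhere the double series of the convolutions
(`ae_integrable_and_conv_eq_tsum`).

The operator `T_ξ` is a contraction by Minkowski's inequality and right invariance, and it fixes
covariant functions. Invariance of `ξ` makes covariant functions covariant on the left as well
(`apply_coe_mul`), whence `T_ξ(f * g) = f * T_ξ g = T_ξ f * T_ξ g`. Finally `T_ξ` is a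
norm-decreasing projection, so `T_ξ f` is a representative of least norm in the class of `f` modulo
the kernel, and the quotient is isometric to the range. -/

noncomputable section

namespace CovariantLp

open Filter Topology

/-! ### Invariance of the Haar measure of a compact group -/

section Invariance

variable {G : Type*} [Group G] [TopologicalSpace G] [IsTopologicalGroup G] [CompactSpace G]
  [MeasurableSpace G] [BorelSpace G]

/-- A right translate of `μ` is again a Haar probability measure, and there is only one. The same
uniqueness argument gives invariance under inversion and under conjugation below. -/
theorem isMulRightInvariant_of_isProbabilityMeasure (μ : Measure G) [μ.IsHaarMeasure]
    [IsProbabilityMeasure μ] : μ.IsMulRightInvariant := by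
  refine ⟨fun g => ?_⟩
  have : IsProbabilityMeasure (μ.map (· * g)) :=
    Measure.isProbabilityMeasure_map (by fun_prop)
  exact Measure.isHaarMeasure_eq_of_isProbabilityMeasure _ _

theorem isInvInvariant_of_isProbabilityMeasure (μ : Measure G) [μ.IsHaarMeasure]
    [IsProbabilityMeasure μ] : μ.IsInvInvariant := by
  have := isMulRightInvariant_of_isProbabilityMeasure μ
  have h1 : IsProbabilityMeasure μ.inv := Measure.isProbabilityMeasure_map (by fun_prop)
  have h2 : μ.inv.IsHaarMeasure :=
    { toIsFiniteMeasureOnCompacts := inferInstance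
      toIsMulLeftInvariant := inferInstance
      toIsOpenPosMeasure := inferInstance }
  exact ⟨Measure.isHaarMeasure_eq_of_isProbabilityMeasure _ _⟩

theorem modularCharacterFun_eq_one (x : G) : Measure.modularCharacterFun x = 1 := by
  -- The modular character may be computed with any Haar measure; the one giving `G` mass 1 is right
  -- invariant.
  let K : TopologicalSpace.PositiveCompacts G := ⊤
  let μ : Measure G := Measure.haarMeasure K
  have : IsProbabilityMeasure μ := ⟨by simpa [K] using Measure.haarMeasure_self (K₀ := K)⟩
  have := isMulRightInvariant_of_isProbabilityMeasure μ
  rw [Measure.modularCharacterFun_eq_haarScalarFactor μ]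
  have h := map_mul_right_eq_self μ x
  calc _ = Measure.haarScalarFactor μ μ := by congr 1
    _ = 1 := Measure.haarScalarFactor_self μ

theorem invol_apply (f : G → ℂ) (x : G) : invol f x = (starRingEnd ℂ) (f x⁻¹) := by
  simp [invol, modularCharacterFun_eq_one]

/-- Conjugation by `x` is a topological automorphism of `N`, so it preserves the Haar probability
measure of `N`. -/
theorem integral_conj_eq_self (N : Subgroup G) [hN : N.Normal] [CompactSpace N] (lN : Measure N)
    [lN.IsHaarMeasure] [IsProbabilityMeasure lN] (x : G) (F : N → ℂ) :
    ∫ s : N, F ⟨x * s * x⁻¹, hN.conj_mem s s.2 x⟩ ∂lN = ∫ s, F s ∂lN := by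
  let e : N ≃ₜ* N :=
    { MulAut.conjNormal x with
      continuous_toFun := by
        refine Continuous.subtype_mk (p := fun y => y ∈ N)
          (f := fun s : N => x * (s : G) * x⁻¹) (by fun_prop) _
      continuous_invFun := by
        refine continuous_induced_rng.2 ?_
        change Continuous fun s : N => (((MulAut.conjNormal x).symm s : N) : G)
        simp only [MulAut.conjNormal_symm_apply]
        fun_prop }
  have h1 : IsProbabilityMeasure (lN.map e) :=
    Measure.isProbabilityMeasure_map e.continuous.measurable.aemeasurable
  have h2 : (lN.map e) = lN := Measure.isHaarMeasure_eq_of_isProbabilityMeasure _ _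
  have h3 : MeasurePreserving e lN lN := ⟨e.continuous.measurable, h2⟩
  exact h3.integral_comp e.toHomeomorph.measurableEmbedding F

end Invariance

/-! ### Integrals of continuous families of continuous functions -/

section Parametric

variable {G K : Type*} [TopologicalSpace G] [CompactSpace G] [MeasurableSpace G] [BorelSpace G]
  [TopologicalSpace K] [CompactSpace K] [MeasurableSpace K] [BorelSpace K]

theorem integrable_of_continuous {E : Type*} [NormedAddCommGroup E] (κ : Measure K)
    [IsFiniteMeasure κ] {f : K → E} (hf : Continuous f) : Integrable f κ :=
  hf.integrable_of_hasCompactSupport (.of_compactSpace f)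

theorem integral_swap_of_continuous (μ : Measure G) [IsFiniteMeasure μ] (κ : Measure K)
    [IsFiniteMeasure κ] {f : G → K → ℂ} (hf : Continuous f.uncurry) :
    ∫ x, (∫ y, f x y ∂κ) ∂μ = ∫ y, (∫ x, f x y ∂μ) ∂κ :=
  integral_integral_swap_of_hasCompactSupport hf (.of_compactSpace _)

/-- The continuous function `x ↦ ∫ F (k, x) dκ(k)`. -/
def paramIntegral (κ : Measure K) (F : C(K × G, ℂ)) : C(G, ℂ) := ∫ k, F.curry k ∂κ

theorem paramIntegral_apply (κ : Measure K) [IsFiniteMeasure κ] (F : C(K × G, ℂ)) (x : G) :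
    paramIntegral κ F x = ∫ k, F (k, x) ∂κ := by
  have h := (ContinuousMap.evalCLM ℂ x : C(G, ℂ) →L[ℂ] ℂ).integral_comp_comm
    (integrable_of_continuous κ F.curry.continuous)
  exact h.symm

/-- Minkowski's integral inequality. Since `paramIntegral` is a Bochner integral in `C(G, ℂ)`, it
commutes with the continuous linear map into `L^p`. -/
theorem norm_toLp_paramIntegral_le (κ : Measure K) [IsFiniteMeasure κ] (p : ℝ≥0∞) [Fact (1 ≤ p)]
    (μ : Measure G) [IsFiniteMeasure μ] (F : C(K × G, ℂ)) :
    ‖ContinuousMap.toLp (E := ℂ) p μ ℂ (paramIntegral κ F)‖ ≤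
      ∫ k, ‖ContinuousMap.toLp (E := ℂ) p μ ℂ (F.curry k)‖ ∂κ := by
  have h := (ContinuousMap.toLp (E := ℂ) p μ ℂ).integral_comp_comm
    (integrable_of_continuous κ F.curry.continuous)
  rw [paramIntegral, ← h]
  exact norm_integral_le_integral_norm _

theorem norm_toLp_eq_of_measurePreserving (p : ℝ≥0∞) [Fact (1 ≤ p)] (μ : Measure G)
    [IsFiniteMeasure μ] {φ : G → G} (hφ : MeasurePreserving φ μ μ) {a b : C(G, ℂ)} {c : ℝ}
    (hc : 0 ≤ c) (h : ∀ x, ‖b x‖ = c * ‖a (φ x)‖) :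
    ‖ContinuousMap.toLp (E := ℂ) p μ ℂ b‖ = c * ‖ContinuousMap.toLp (E := ℂ) p μ ℂ a‖ := by
  rw [Lp.norm_def, Lp.norm_def, eLpNorm_congr_ae (ContinuousMap.coeFn_toLp (𝕜 := ℂ) μ b),
    eLpNorm_congr_ae (ContinuousMap.coeFn_toLp (𝕜 := ℂ) μ a),
    ← eLpNorm_comp_measurePreserving a.continuous.aestronglyMeasurable hφ,
    eLpNorm_congr_norm_ae (g := c • (a ∘ φ)) (.of_forall fun x => by
      simp [h, abs_of_nonneg hc]),
    eLpNorm_const_smul, ENNReal.toReal_mul]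
  simp [abs_of_nonneg hc]

theorem integral_norm_le_norm_toLp (p : ℝ≥0∞) [Fact (1 ≤ p)] (μ : Measure G)
    [IsProbabilityMeasure μ] (a : C(G, ℂ)) :
    ∫ x, ‖a x‖ ∂μ ≤ ‖ContinuousMap.toLp (E := ℂ) p μ ℂ a‖ := by
  rw [Lp.norm_def, eLpNorm_congr_ae (ContinuousMap.coeFn_toLp (𝕜 := ℂ) μ a),
    integral_norm_eq_lintegral_enorm a.continuous.aestronglyMeasurable, ← eLpNorm_one_eq_lintegral_enorm]
  refine ENNReal.toReal_mono ?_
    (eLpNorm_le_eLpNorm_of_exponent_le Fact.out a.continuous.aestronglyMeasurable)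
  rw [← eLpNorm_congr_ae (ContinuousMap.coeFn_toLp (p := p) (𝕜 := ℂ) μ a)]
  exact Lp.eLpNorm_ne_top _

end Parametric

/-! ### Absolutely convergent series in `L^p` -/

section Series

variable {G : Type*} [MeasurableSpace G] {μ : Measure G} [IsProbabilityMeasure μ] {p : ℝ≥0∞}

theorem lintegral_enorm_le_enorm [hp1 : Fact (1 ≤ p)] (f : Lp ℂ p μ) : ∫⁻ x, ‖f x‖ₑ ∂μ ≤ ‖f‖ₑ := by
  rw [← eLpNorm_one_eq_lintegral_enorm, Lp.enorm_def]
  exact eLpNorm_le_eLpNorm_of_exponent_le hp1.out (Lp.aestronglyMeasurable f)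

theorem ae_summable_norm_of_tsum_lintegral {ι : Type*} [Countable ι] {c : ι → G → ℂ}
    (hc : ∀ i, AEStronglyMeasurable (c i) μ) (h : ∑' i, ∫⁻ x, ‖c i x‖ₑ ∂μ ≠ ∞) :
    ∀ᵐ x ∂μ, Summable fun i => ‖c i x‖ := by
  rw [← lintegral_tsum fun i => (hc i).enorm] at h
  filter_upwards [ae_lt_top' (AEMeasurable.tsum fun i => (hc i).enorm) h] with x hx
  exact tsum_enorm_ne_top_iff_summable_norm.1 hx.ne

theorem ae_summable_norm_of_summable_norm [Fact (1 ≤ p)] {ι : Type*} [Countable ι]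
    {c : ι → Lp ℂ p μ} (hc : Summable fun i => ‖c i‖) :
    ∀ᵐ x ∂μ, Summable fun i => ‖c i x‖ := by
  refine ae_summable_norm_of_tsum_lintegral (fun i => Lp.aestronglyMeasurable (c i)) ?_
  refine ne_top_of_le_ne_top ?_ (ENNReal.tsum_le_tsum fun i => lintegral_enorm_le_enorm (c i))
  exact tsum_enorm_ne_top_iff_summable_norm.2 hc

theorem coeFn_sum_apply {ι : Type*} (s : Finset ι) (c : ι → Lp ℂ p μ) :
    ∀ᵐ x ∂μ, (∑ i ∈ s, c i : Lp ℂ p μ) x = ∑ i ∈ s, c i x := by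
  classical
  induction s using Finset.induction_on with
  | empty => simpa using Lp.coeFn_zero ℂ p μ
  | insert i s hi ih =>
    rw [Finset.sum_insert hi]
    filter_upwards [ih, Lp.coeFn_add (c i) (∑ i ∈ s, c i)] with x h1 h2
    rw [h2, Pi.add_apply, h1, Finset.sum_insert hi]

/-- Convergence in `L^p` gives almost everywhere convergence only along a sequence of finite sets;
since the series also converges absolutely almost everywhere, its pointwise sum must be that limit.
-/
theorem ae_eq_tsum_of_hasSum [Fact (1 ≤ p)] {ι : Type*} [Countable ι] {c : ι → Lp ℂ p μ}
    (hc : Summable fun i => ‖c i‖) {f : Lp ℂ p μ} (hf : HasSum c f) :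
    ∀ᵐ x ∂μ, f x = ∑' i, c i x := by
  have hm : TendstoInMeasure μ (fun s : Finset ι => ((∑ i ∈ s, c i : Lp ℂ p μ) : G → ℂ)) atTop f :=
    tendstoInMeasure_of_tendsto_Lp hf
  obtain ⟨ns, hns, hlim⟩ := hm.exists_seq_tendsto_ae'
  have hsum : ∀ᵐ x ∂μ, ∀ s : Finset ι, (∑ i ∈ s, c i : Lp ℂ p μ) x = ∑ i ∈ s, c i x :=
    ae_all_iff.2 fun s => coeFn_sum_apply s c
  filter_upwards [hlim, hsum, ae_summable_norm_of_summable_norm hc] with x h1 h2 h3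
  simp only [h2] at h1
  exact tendsto_nhds_unique h1 (h3.of_norm.hasSum.comp hns)

theorem exists_hasSum_of_denseRange {E F : Type*} [NormedAddCommGroup E] [NormedAddCommGroup F]
    [CompleteSpace F]
    (j : E →+ F) (hj : DenseRange j) (f : F) {ε : ℝ} (hε : 0 < ε) :
    ∃ a : ℕ → E, (Summable fun n => ‖j (a n)‖) ∧ HasSum (fun n => j (a n)) f ∧
      ∑' n, ‖j (a n)‖ ≤ ‖f‖ + ε := by
  have hf : f ∈ closure (j.range : Set F) := by
    rw [AddMonoidHom.coe_range]
    exact hj f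
  -- The tolerances `ε / 2 / 2 ^ n` add up to `ε`; only the term `n = 0` carries the size of `f`.
  obtain ⟨a, ha, h0, hn⟩ := controlled_sum_of_mem_closure_range (j := j) hf
    (f := fun n => ε / 2 / 2 ^ n) (fun n => by positivity)
  have hb : HasSum (fun n : ℕ => (if n = 0 then ‖f‖ else 0) + ε / 2 / 2 ^ n) (‖f‖ + ε) :=
    (hasSum_ite_eq 0 ‖f‖).add (hasSum_geometric_two' ε)
  have hle : ∀ n, ‖j (a n)‖ ≤ (if n = 0 then ‖f‖ else 0) + ε / 2 / 2 ^ n := by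
    intro n
    rcases Nat.eq_zero_or_pos n with rfl | h
    · have h1 : ‖j (a 0)‖ ≤ ‖f‖ + ‖-j (a 0) + f‖ := by
        simpa [norm_sub_rev, sub_eq_neg_add] using norm_sub_le f (-j (a 0) + f)
      simpa using h1.trans (add_le_add_right h0.le _)
    · simpa [h.ne'] using (hn n h).le
  have hs : Summable fun n => ‖j (a n)‖ := hb.summable.of_nonneg_of_le (fun _ => norm_nonneg _) hle
  refine ⟨a, hs, ?_, hb.tsum_eq ▸ hs.tsum_le_tsum hle hb.summable⟩
  have h := hs.of_norm.hasSum
  -- The partial sums in `ha` run over `range (n + 1)`, hence the shift.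
  rwa [tendsto_nhds_unique (h.tendsto_sum_nat.comp (tendsto_add_atTop_nat 1)) ha] at h

end Series

/-! ### Convolution on `L^p(G)` -/

theorem integrable_tsum_of_summable_integral_norm {α ι : Type*} [MeasurableSpace α] [Countable ι]
    {μ : Measure α} {F : ι → α → ℂ} (hF : ∀ i, Integrable (F i) μ)
    (hs : Summable fun i => ∫ x, ‖F i x‖ ∂μ) {f : α → ℂ} (hf : AEStronglyMeasurable f μ)
    (hfF : ∀ᵐ x ∂μ, f x = ∑' i, F i x) : Integrable f μ := by
  refine ⟨hf, lt_of_le_of_lt ?_ (lt_top_iff_ne_top.2 (tsum_enorm_ne_top_iff_summable_norm.2 hs.norm))⟩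
  calc ∫⁻ x, ‖f x‖ₑ ∂μ ≤ ∫⁻ x, ∑' i, ‖F i x‖ₑ ∂μ := by
        refine lintegral_mono_ae (hfF.mono fun x hx => ?_)
        rw [hx]
        exact enorm_tsum_le_tsum_enorm
    _ = ∑' i, ‖∫ x, ‖F i x‖ ∂μ‖ₑ := by
        rw [lintegral_tsum fun i => (hF i).1.enorm]
        refine tsum_congr fun i => ?_
        rw [← ofReal_integral_norm_eq_lintegral_enorm (hF i),
          Real.enorm_of_nonneg (integral_nonneg fun _ => norm_nonneg _)]

section Convolution

variable {G : Type*} [Group G] [TopologicalSpace G] [IsTopologicalGroup G] [CompactSpace G]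
  [MeasurableSpace G] [BorelSpace G]

theorem measurePreserving_inv_mul (μ : Measure G) [μ.IsHaarMeasure] [IsProbabilityMeasure μ]
    (x : G) : MeasurePreserving (fun y => y⁻¹ * x) μ μ := by
  have := isMulRightInvariant_of_isProbabilityMeasure μ
  have := isInvInvariant_of_isProbabilityMeasure μ
  exact (measurePreserving_mul_right μ x).comp (Measure.measurePreserving_inv μ)

/-- Equality holds at every `x`, because `y ↦ y⁻¹ * x` pulls null sets back to null sets. -/
theorem conv_congr {μ : Measure G} [μ.IsHaarMeasure] [IsProbabilityMeasure μ] {f f' g g' : G → ℂ}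
    (hf : f =ᵐ[μ] f') (hg : g =ᵐ[μ] g') : conv μ f g = conv μ f' g' := by
  funext x
  refine integral_congr_ae ?_
  filter_upwards [hf, (measurePreserving_inv_mul μ x).quasiMeasurePreserving.ae hg] with y h1 h2
  rw [h1, h2]

/-- Convolution of continuous functions, as a continuous function. -/
def convC (μ : Measure G) (f g : C(G, ℂ)) : C(G, ℂ) :=
  paramIntegral μ ⟨fun z : G × G => f z.1 * g (z.1⁻¹ * z.2), by fun_prop⟩

variable {p : ℝ≥0∞} {μ : Measure G} [μ.IsHaarMeasure] [IsProbabilityMeasure μ]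

theorem convC_apply (f g : C(G, ℂ)) (x : G) : convC μ f g x = ∫ y, f y * g (y⁻¹ * x) ∂μ :=
  paramIntegral_apply μ _ x

theorem ofFun_coe [Fact (1 ≤ p)] (f : C(G, ℂ)) :
    ofFun p μ f = ContinuousMap.toLp (E := ℂ) p μ ℂ f := by
  have h : MemLp f p μ := (memLp_congr_ae (ContinuousMap.coeFn_toLp (𝕜 := ℂ) μ f)).1 (Lp.memLp _)
  rw [ofFun, dif_pos h]
  refine Lp.ext ?_
  exact h.coeFn_toLp.trans (ContinuousMap.coeFn_toLp (𝕜 := ℂ) μ f).symm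

theorem convLp_toLp [Fact (1 ≤ p)] (f g : C(G, ℂ)) :
    convLp (ContinuousMap.toLp (E := ℂ) p μ ℂ f) (ContinuousMap.toLp (E := ℂ) p μ ℂ g) =
      ContinuousMap.toLp (E := ℂ) p μ ℂ (convC μ f g) := by
  rw [convLp, conv_congr (ContinuousMap.coeFn_toLp (𝕜 := ℂ) μ f)
    (ContinuousMap.coeFn_toLp (𝕜 := ℂ) μ g), ← ofFun_coe]
  congr 1
  funext x
  rw [convC_apply, conv]

/-- Minkowski's inequality for the average of the left translates of `g`, which all have the same
norm, followed by `‖f‖_1 ≤ ‖f‖_p`. -/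
theorem norm_toLp_convC_le [Fact (1 ≤ p)] (f g : C(G, ℂ)) :
    ‖ContinuousMap.toLp (E := ℂ) p μ ℂ (convC μ f g)‖ ≤
      ‖ContinuousMap.toLp (E := ℂ) p μ ℂ f‖ * ‖ContinuousMap.toLp (E := ℂ) p μ ℂ g‖ := by
  refine (norm_toLp_paramIntegral_le μ p μ _).trans ?_
  have h (y : G) : ‖ContinuousMap.toLp (E := ℂ) p μ ℂ (ContinuousMap.curry
      ⟨fun z : G × G => f z.1 * g (z.1⁻¹ * z.2), by fun_prop⟩ y)‖ =
      ‖f y‖ * ‖ContinuousMap.toLp (E := ℂ) p μ ℂ g‖ :=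
    norm_toLp_eq_of_measurePreserving p μ (measurePreserving_mul_left μ y⁻¹) (norm_nonneg _)
      fun x => by simp
  simp only [h, integral_mul_const]
  gcongr
  exact integral_norm_le_norm_toLp p μ f

/-- The pointwise absolute value of a continuous function. -/
def absC (f : C(G, ℂ)) : C(G, ℂ) := ⟨fun x => (‖f x‖ : ℂ), by fun_prop⟩

theorem norm_toLp_absC [Fact (1 ≤ p)] (f : C(G, ℂ)) :
    ‖ContinuousMap.toLp (E := ℂ) p μ ℂ (absC f)‖ = ‖ContinuousMap.toLp (E := ℂ) p μ ℂ f‖ := by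
  simpa using norm_toLp_eq_of_measurePreserving p μ (MeasurePreserving.id μ) (a := f) (b := absC f)
    zero_le_one fun x => by simp [absC]

/-- Lets the integrals of absolute values in the double series be controlled by `L^p` norms of
convolutions. -/
theorem norm_convC_absC (f g : C(G, ℂ)) (x : G) :
    ‖convC μ (absC f) (absC g) x‖ = ∫ y, ‖f y * g (y⁻¹ * x)‖ ∂μ := by
  rw [convC_apply]
  simp only [absC, ContinuousMap.coe_mk, ← Complex.ofReal_mul, ← norm_mul]
  rw [integral_complex_ofReal, Complex.norm_real, Real.norm_of_nonneg]
  exact integral_nonneg fun _ => norm_nonneg _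

section

variable [Fact (1 ≤ p)] {f g : Lp ℂ p μ} {a b : ℕ → C(G, ℂ)}
  (ha : Summable fun n => ‖ContinuousMap.toLp (E := ℂ) p μ ℂ (a n)‖)
  (hb : Summable fun n => ‖ContinuousMap.toLp (E := ℂ) p μ ℂ (b n)‖)

include ha in
theorem ae_hasSum_of_toLp (haf : HasSum (fun n => ContinuousMap.toLp (E := ℂ) p μ ℂ (a n)) f) :
    ∀ᵐ x ∂μ, (Summable fun n => ‖a n x‖) ∧ f x = ∑' n, a n x := by
  have h : ∀ᵐ x ∂μ, ∀ n, ContinuousMap.toLp (E := ℂ) p μ ℂ (a n) x = a n x :=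
    ae_all_iff.2 fun n => ContinuousMap.coeFn_toLp (𝕜 := ℂ) μ (a n)
  filter_upwards [h, ae_summable_norm_of_summable_norm ha, ae_eq_tsum_of_hasSum ha haf]
    with x h1 h2 h3
  simp only [h1] at h2 h3
  exact ⟨h2, h3⟩

include ha hb in
theorem summable_norm_toLp_convC :
    Summable fun i : ℕ × ℕ => ‖ContinuousMap.toLp (E := ℂ) p μ ℂ (convC μ (a i.1) (b i.2))‖ :=
  (ha.mul_of_nonneg hb (fun _ => norm_nonneg _) fun _ => norm_nonneg _).of_nonneg_of_le
    (fun _ => norm_nonneg _) fun _ => norm_toLp_convC_le _ _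

include ha hb in
-- The series of `|a m| * |b n|` is absolutely summable in `L^p`, hence at almost every `x`. At such
-- `x` the double series for `f y * g (y⁻¹ * x)` may be integrated term by term.
theorem ae_integrable_and_conv_eq_tsum
    (haf : HasSum (fun n => ContinuousMap.toLp (E := ℂ) p μ ℂ (a n)) f)
    (hbg : HasSum (fun n => ContinuousMap.toLp (E := ℂ) p μ ℂ (b n)) g) :
    ∀ᵐ x ∂μ, Integrable (fun y => f y * g (y⁻¹ * x)) μ ∧
      conv μ f g x = ∑' i : ℕ × ℕ, convC μ (a i.1) (b i.2) x := by
  have hA : Summable fun n => ‖ContinuousMap.toLp (E := ℂ) p μ ℂ (absC (a n))‖ := by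
    simpa only [norm_toLp_absC] using ha
  have hB : Summable fun n => ‖ContinuousMap.toLp (E := ℂ) p μ ℂ (absC (b n))‖ := by
    simpa only [norm_toLp_absC] using hb
  have hconv := summable_norm_toLp_convC hA hB
  have h0 : ∀ᵐ x ∂μ, ∀ i : ℕ × ℕ, ContinuousMap.toLp (E := ℂ) p μ ℂ
      (convC μ (absC (a i.1)) (absC (b i.2))) x = convC μ (absC (a i.1)) (absC (b i.2)) x :=
    ae_all_iff.2 fun n => ContinuousMap.coeFn_toLp (𝕜 := ℂ) μ _
  filter_upwards [h0, ae_summable_norm_of_summable_norm hconv] with x h0 hx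
  simp only [h0, norm_convC_absC] at hx
  have hint (i : ℕ × ℕ) : Integrable (fun y => a i.1 y * b i.2 (y⁻¹ * x)) μ :=
    integrable_of_continuous μ (by fun_prop)
  have heq : ∀ᵐ y ∂μ, f y * g (y⁻¹ * x) = ∑' i : ℕ × ℕ, a i.1 y * b i.2 (y⁻¹ * x) := by
    filter_upwards [ae_hasSum_of_toLp ha haf,
      (measurePreserving_inv_mul μ x).quasiMeasurePreserving.ae (ae_hasSum_of_toLp hb hbg)]
      with y h1 h2
    rw [h1.2, h2.2, tsum_mul_tsum_of_summable_norm h1.1 h2.1]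
  refine ⟨integrable_tsum_of_summable_integral_norm hint hx ((Lp.aestronglyMeasurable f).mul
    ((Lp.aestronglyMeasurable g).comp_measurePreserving (measurePreserving_inv_mul μ x))) heq, ?_⟩
  rw [conv, integral_congr_ae heq, ← (hasSum_integral_of_summable_integral_norm hint hx).tsum_eq]
  simp only [convC_apply]

include ha hb in
theorem conv_ae_eq_tsum
    (haf : HasSum (fun n => ContinuousMap.toLp (E := ℂ) p μ ℂ (a n)) f)
    (hbg : HasSum (fun n => ContinuousMap.toLp (E := ℂ) p μ ℂ (b n)) g) :
    conv μ f g =ᵐ[μ]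
      (∑' i : ℕ × ℕ, ContinuousMap.toLp (E := ℂ) p μ ℂ (convC μ (a i.1) (b i.2)) : Lp ℂ p μ) := by
  have hs := summable_norm_toLp_convC ha hb
  have h0 : ∀ᵐ x ∂μ, ∀ i : ℕ × ℕ, ContinuousMap.toLp (E := ℂ) p μ ℂ
      (convC μ (a i.1) (b i.2)) x = convC μ (a i.1) (b i.2) x :=
    ae_all_iff.2 fun n => ContinuousMap.coeFn_toLp (𝕜 := ℂ) μ _
  filter_upwards [ae_integrable_and_conv_eq_tsum ha hb haf hbg,
    ae_eq_tsum_of_hasSum hs hs.of_norm.hasSum, h0] with x h1 h2 h3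
  rw [h1.2, h2]
  simp only [h3]

end

variable [Fact (1 ≤ p)] [T2Space G]

theorem toLp_dense (hp : p ≠ ∞) : DenseRange (ContinuousMap.toLp (E := ℂ) p μ ℂ) :=
  ContinuousMap.toLp_denseRange ℂ μ ℂ hp

theorem exists_hasSum_toLp (hp : p ≠ ∞) (f : Lp ℂ p μ) {ε : ℝ} (hε : 0 < ε) :
    ∃ a : ℕ → C(G, ℂ), (Summable fun n => ‖ContinuousMap.toLp (E := ℂ) p μ ℂ (a n)‖) ∧
      HasSum (fun n => ContinuousMap.toLp (E := ℂ) p μ ℂ (a n)) f ∧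
      ∑' n, ‖ContinuousMap.toLp (E := ℂ) p μ ℂ (a n)‖ ≤ ‖f‖ + ε :=
  exists_hasSum_of_denseRange (ContinuousMap.toLp (E := ℂ) p μ ℂ).toLinearMap.toAddMonoidHom
    (toLp_dense hp) f hε

theorem ae_integrable_conv (hp : p ≠ ∞) (f g : Lp ℂ p μ) :
    ∀ᵐ x ∂μ, Integrable (fun y => f y * g (y⁻¹ * x)) μ := by
  obtain ⟨a, ha, haf, -⟩ := exists_hasSum_toLp hp f one_pos
  obtain ⟨b, hb, hbg, -⟩ := exists_hasSum_toLp hp g one_pos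
  exact (ae_integrable_and_conv_eq_tsum ha hb haf hbg).mono fun x hx => hx.1

theorem memLp_conv (hp : p ≠ ∞) (f g : Lp ℂ p μ) : MemLp (conv μ f g) p μ := by
  obtain ⟨a, ha, haf, -⟩ := exists_hasSum_toLp hp f one_pos
  obtain ⟨b, hb, hbg, -⟩ := exists_hasSum_toLp hp g one_pos
  exact (memLp_congr_ae (conv_ae_eq_tsum ha hb haf hbg)).2 (Lp.memLp _)

theorem coeFn_convLp (hp : p ≠ ∞) (f g : Lp ℂ p μ) : convLp f g =ᵐ[μ] conv μ f g := by
  rw [convLp, ofFun, dif_pos (memLp_conv hp f g)]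
  exact MemLp.coeFn_toLp _

theorem norm_convLp_le (hp : p ≠ ∞) (f g : Lp ℂ p μ) : ‖convLp f g‖ ≤ ‖f‖ * ‖g‖ := by
  -- Expansions that are optimal up to `ε` keep the constant 1 in the product estimate.
  have key : ∀ ε > 0, ‖convLp f g‖ ≤ (‖f‖ + ε) * (‖g‖ + ε) := by
    intro ε hε
    obtain ⟨a, ha, haf, ha'⟩ := exists_hasSum_toLp hp f hε
    obtain ⟨b, hb, hbg, hb'⟩ := exists_hasSum_toLp hp g hε
    have hs := summable_norm_toLp_convC ha hb
    have hab := ha.mul_of_nonneg hb (fun _ => norm_nonneg _) fun _ => norm_nonneg _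
    rw [Lp.ext ((coeFn_convLp hp f g).trans (conv_ae_eq_tsum ha hb haf hbg))]
    calc _ ≤ _ := norm_tsum_le_tsum_norm hs
      _ ≤ _ := hs.tsum_le_tsum (fun i => norm_toLp_convC_le _ _) hab
      _ = _ := (ha.tsum_mul_tsum hb hab).symm
      _ ≤ _ := mul_le_mul ha' hb' (tsum_nonneg fun _ => norm_nonneg _) (by positivity)
  have hlim : Tendsto (fun ε : ℝ => (‖f‖ + ε) * (‖g‖ + ε)) (𝓝[>] 0) (𝓝 (‖f‖ * ‖g‖)) := by
    have : ContinuousAt (fun ε : ℝ => (‖f‖ + ε) * (‖g‖ + ε)) 0 := by fun_prop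
    simpa using this.tendsto.mono_left nhdsWithin_le_nhds
  exact ge_of_tendsto hlim (eventually_mem_nhdsWithin.mono fun ε hε => key ε hε)

theorem ae_comp_inv_mul {P : G → Prop} (h : ∀ᵐ y ∂μ, P y) (x : G) : ∀ᵐ y ∂μ, P (y⁻¹ * x) :=
  (measurePreserving_inv_mul μ x).quasiMeasurePreserving.ae h

theorem convLp_add (hp : p ≠ ∞) (f g h : Lp ℂ p μ) :
    convLp f (g + h) = convLp f g + convLp f h := by
  refine Lp.ext ?_
  filter_upwards [coeFn_convLp hp f (g + h), coeFn_convLp hp f g, coeFn_convLp hp f h,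
    Lp.coeFn_add (convLp f g) (convLp f h), ae_integrable_conv hp f g, ae_integrable_conv hp f h]
    with x h1 h2 h3 h4 h5 h6
  rw [h1, h4, Pi.add_apply, h2, h3, conv, conv, conv, ← integral_add h5 h6]
  refine integral_congr_ae ((ae_comp_inv_mul (Lp.coeFn_add g h) x).mono fun y hy => ?_)
  simp only [hy, Pi.add_apply, mul_add]

theorem add_convLp (hp : p ≠ ∞) (f g h : Lp ℂ p μ) :
    convLp (f + g) h = convLp f h + convLp g h := by
  refine Lp.ext ?_
  filter_upwards [coeFn_convLp hp (f + g) h, coeFn_convLp hp f h, coeFn_convLp hp g h,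
    Lp.coeFn_add (convLp f h) (convLp g h), ae_integrable_conv hp f h, ae_integrable_conv hp g h]
    with x h1 h2 h3 h4 h5 h6
  rw [h1, h4, Pi.add_apply, h2, h3, conv, conv, conv, ← integral_add h5 h6]
  refine integral_congr_ae ((Lp.coeFn_add f g).mono fun y hy => ?_)
  simp only [hy, Pi.add_apply, add_mul]

theorem convLp_smul (hp : p ≠ ∞) (z : ℂ) (f g : Lp ℂ p μ) :
    convLp f (z • g) = z • convLp f g := by
  refine Lp.ext ?_
  filter_upwards [coeFn_convLp hp f (z • g), coeFn_convLp hp f g,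
    Lp.coeFn_smul z (convLp f g)] with x h1 h2 h3
  rw [h1, h3, Pi.smul_apply, h2, conv, conv, ← integral_smul]
  refine integral_congr_ae ((ae_comp_inv_mul (Lp.coeFn_smul z g) x).mono fun y hy => ?_)
  simp only [hy, Pi.smul_apply, smul_eq_mul, mul_left_comm]

theorem smul_convLp (hp : p ≠ ∞) (z : ℂ) (f g : Lp ℂ p μ) :
    convLp (z • f) g = z • convLp f g := by
  refine Lp.ext ?_
  filter_upwards [coeFn_convLp hp (z • f) g, coeFn_convLp hp f g,
    Lp.coeFn_smul z (convLp f g)] with x h1 h2 h3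
  rw [h1, h3, Pi.smul_apply, h2, conv, conv, ← integral_smul]
  refine integral_congr_ae ((Lp.coeFn_smul z f).mono fun y hy => ?_)
  simp only [hy, Pi.smul_apply, smul_eq_mul, mul_assoc]

/-- Convolution on `L^p(G)` as a continuous bilinear map. -/
def convCLM (hp : p ≠ ∞) : Lp ℂ p μ →L[ℂ] Lp ℂ p μ →L[ℂ] Lp ℂ p μ :=
  LinearMap.mkContinuous₂ (LinearMap.mk₂ ℂ convLp (add_convLp hp) (smul_convLp hp)
    (convLp_add hp) (convLp_smul hp)) 1 fun f g => by
      simpa using norm_convLp_le hp f g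

theorem continuous_convLp (hp : p ≠ ∞) :
    Continuous fun z : Lp ℂ p μ × Lp ℂ p μ => convLp z.1 z.2 :=
  (convCLM (μ := μ) hp).continuous₂

end Convolution

/-! ### The Banach `*`-algebra `L^p(G)` -/

section Involution

variable {G : Type*} [Group G] [TopologicalSpace G] [IsTopologicalGroup G]

/-- Involution of continuous functions, as a continuous function. -/
def involC (f : C(G, ℂ)) : C(G, ℂ) := ⟨fun x => (starRingEnd ℂ) (f x⁻¹), by fun_prop⟩

theorem involC_apply (f : C(G, ℂ)) (x : G) : involC f x = (starRingEnd ℂ) (f x⁻¹) := rfl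

variable [CompactSpace G] [MeasurableSpace G] [BorelSpace G]

theorem measurePreserving_inv_of_isProbabilityMeasure (μ : Measure G) [μ.IsHaarMeasure]
    [IsProbabilityMeasure μ] : MeasurePreserving (fun y => y⁻¹) μ μ := by
  have := isInvInvariant_of_isProbabilityMeasure μ
  exact Measure.measurePreserving_inv μ

variable {p : ℝ≥0∞} {μ : Measure G} [μ.IsHaarMeasure] [IsProbabilityMeasure μ]

theorem ae_comp_inv {P : G → Prop} (h : ∀ᵐ y ∂μ, P y) : ∀ᵐ y ∂μ, P y⁻¹ :=
  (measurePreserving_inv_of_isProbabilityMeasure μ).quasiMeasurePreserving.ae h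

theorem memLp_invol {f : G → ℂ} (hf : MemLp f p μ) : MemLp (invol f) p μ := by
  have h := (hf.comp_measurePreserving (measurePreserving_inv_of_isProbabilityMeasure μ)).star
  refine (memLp_congr_ae (.of_forall fun x => ?_)).1 h
  simp [invol_apply]

theorem coeFn_involLp (f : Lp ℂ p μ) : ∀ᵐ x ∂μ, involLp f x = (starRingEnd ℂ) (f x⁻¹) := by
  have h := memLp_invol (Lp.memLp f)
  rw [involLp, ofFun, dif_pos h]
  filter_upwards [h.coeFn_toLp] with x hx
  rw [hx, invol_apply]

theorem involLp_toLp [Fact (1 ≤ p)] (f : C(G, ℂ)) :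
    involLp (ContinuousMap.toLp (E := ℂ) p μ ℂ f) =
      ContinuousMap.toLp (E := ℂ) p μ ℂ (involC f) := by
  refine Lp.ext ?_
  filter_upwards [coeFn_involLp (ContinuousMap.toLp (E := ℂ) p μ ℂ f),
    ContinuousMap.coeFn_toLp (p := p) (𝕜 := ℂ) μ (involC f),
    ae_comp_inv (ContinuousMap.coeFn_toLp (p := p) (𝕜 := ℂ) μ f)] with x h1 h2 h3
  rw [h1, h2, h3, involC_apply]

theorem involLp_add (f g : Lp ℂ p μ) : involLp (f + g) = involLp f + involLp g := by
  refine Lp.ext ?_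
  filter_upwards [coeFn_involLp (f + g), coeFn_involLp f, coeFn_involLp g,
    Lp.coeFn_add (involLp f) (involLp g), ae_comp_inv (Lp.coeFn_add f g)] with x h1 h2 h3 h4 h5
  rw [h1, h4, Pi.add_apply, h2, h3, h5, Pi.add_apply, map_add]

theorem involLp_smul (z : ℂ) (f : Lp ℂ p μ) :
    involLp (z • f) = (starRingEnd ℂ) z • involLp f := by
  refine Lp.ext ?_
  filter_upwards [coeFn_involLp (z • f), coeFn_involLp f,
    Lp.coeFn_smul ((starRingEnd ℂ) z) (involLp f), ae_comp_inv (Lp.coeFn_smul z f)]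
    with x h1 h2 h3 h4
  rw [h1, h3, Pi.smul_apply, h2, h4, Pi.smul_apply, smul_eq_mul, smul_eq_mul, map_mul]

theorem involLp_involLp (f : Lp ℂ p μ) : involLp (involLp f) = f := by
  refine Lp.ext ?_
  filter_upwards [coeFn_involLp (involLp f), ae_comp_inv (coeFn_involLp f)] with x h1 h2
  rw [h1, h2, inv_inv, Complex.conj_conj]

theorem norm_involLp (f : Lp ℂ p μ) : ‖involLp f‖ = ‖f‖ := by
  rw [Lp.norm_def, Lp.norm_def, ← eLpNorm_comp_measurePreserving (Lp.aestronglyMeasurable f)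
    (measurePreserving_inv_of_isProbabilityMeasure μ)]
  congr 1
  refine eLpNorm_congr_norm_ae ((coeFn_involLp f).mono fun x hx => ?_)
  simp [hx]

theorem continuous_involLp [Fact (1 ≤ p)] : Continuous (involLp : Lp ℂ p μ → Lp ℂ p μ) :=
  AddMonoidHomClass.continuous_of_bound
    (AddMonoidHom.mk' (involLp : Lp ℂ p μ → Lp ℂ p μ) involLp_add) 1
    fun f => by simpa using (norm_involLp f).le

theorem convC_assoc (f g h : C(G, ℂ)) : convC μ (convC μ f g) h = convC μ f (convC μ g h) := by
  ext x
  simp only [convC_apply, ← integral_mul_const, ← integral_const_mul]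
  rw [integral_swap_of_continuous μ μ (by fun_prop)]
  refine integral_congr_ae (.of_forall fun y => ?_)
  -- The substitution `z ↦ y * z`, available once the `z` integral is the inner one.
  have := integral_mul_left_eq_self (μ := μ) (fun z => f y * (g (y⁻¹ * z)) * h (z⁻¹ * x)) y
  simp only [← this]
  refine integral_congr_ae (.of_forall fun z => ?_)
  simp [mul_assoc]

/-- The substitution `y ↦ x⁻¹ * y` turns `f y * g (y⁻¹ * x⁻¹)` into `f (x⁻¹ * y) * g y⁻¹`. -/
theorem involC_convC (f g : C(G, ℂ)) :
    involC (convC μ f g) = convC μ (involC g) (involC f) := by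
  have := isInvInvariant_of_isProbabilityMeasure μ
  ext x
  rw [involC_apply, convC_apply, convC_apply, ← integral_conj]
  rw [← integral_mul_left_eq_self (μ := μ) _ x⁻¹, ← integral_inv_eq_self _ μ,
    ← integral_inv_eq_self _ μ]
  refine integral_congr_ae (.of_forall fun y => ?_)
  simp [involC_apply, mul_comm]

variable [Fact (1 ≤ p)] [T2Space G]

theorem convLp_assoc (hp : p ≠ ∞) (f g h : Lp ℂ p μ) :
    convLp (convLp f g) h = convLp f (convLp g h) := by
  have hc := continuous_convLp (μ := μ) hp
  refine (toLp_dense (μ := μ) hp).induction_on₃ (p := fun f g h =>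
    convLp (convLp f g) h = convLp f (convLp g h)) (isClosed_eq ?_ ?_) (fun f g h => ?_) f g h
  · exact hc.comp₂ (hc.comp₂ (by fun_prop) (by fun_prop)) (by fun_prop)
  · exact hc.comp₂ (by fun_prop) (hc.comp₂ (by fun_prop) (by fun_prop))
  · simp only [convLp_toLp, convC_assoc]

theorem involLp_convLp (hp : p ≠ ∞) (f g : Lp ℂ p μ) :
    involLp (convLp f g) = convLp (involLp g) (involLp f) := by
  have hc := continuous_convLp (μ := μ) hp
  have hi := continuous_involLp (μ := μ) (p := p)
  refine (toLp_dense (μ := μ) hp).induction_on₂ (p := fun f g =>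
    involLp (convLp f g) = convLp (involLp g) (involLp f)) (isClosed_eq ?_ ?_)
    (fun f g => ?_) f g
  · exact hi.comp hc
  · exact hc.comp₂ (hi.comp continuous_snd) (hi.comp continuous_fst)
  · simp only [convLp_toLp, involLp_toLp, involC_convC]

theorem isBanachStarAlgebra_Lp (hp : p ≠ ∞) :
    IsBanachStarAlgebra (A := Lp ℂ p μ) convLp involLp where
  eq_zero_of_norm_eq_zero _ := norm_eq_zero.1
  complete := inferInstance
  mul_add := convLp_add hp
  add_mul := add_convLp hp
  smul_mul := smul_convLp hp
  mul_smul := convLp_smul hp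
  mul_assoc := convLp_assoc hp
  norm_mul_le := norm_convLp_le hp
  star_add := involLp_add
  star_smul := involLp_smul
  star_star := involLp_involLp
  star_mul := involLp_convLp hp
  norm_star := norm_involLp

end Involution

/-! ### Subalgebras and isometric copies of Banach `*`-algebras -/

theorem IsBanachStarAlgebra.submodule {A : Type*} [NormedAddCommGroup A] [NormedSpace ℂ A]
    {mul : A → A → A} {star : A → A} (h : IsBanachStarAlgebra mul star) (S : Submodule ℂ A)
    (hS : IsClosed (S : Set A)) (hmul : ∀ a b : S, mul a b ∈ S) (hstar : ∀ a : S, star a ∈ S) :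
    IsBanachStarAlgebra (A := S) (fun a b => ⟨mul a b, hmul a b⟩) (fun a => ⟨star a, hstar a⟩) where
  eq_zero_of_norm_eq_zero _ := norm_eq_zero.1
  complete := have := h.complete; hS.completeSpace_coe
  mul_add a b c := Subtype.ext (h.mul_add a b c)
  add_mul a b c := Subtype.ext (h.add_mul a b c)
  smul_mul z a b := Subtype.ext (h.smul_mul z a b)
  mul_smul z a b := Subtype.ext (h.mul_smul z a b)
  mul_assoc a b c := Subtype.ext (h.mul_assoc a b c)
  norm_mul_le a b := h.norm_mul_le a b
  star_add a b := Subtype.ext (h.star_add a b)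
  star_smul z a := Subtype.ext (h.star_smul z a)
  star_star a := Subtype.ext (h.star_star a)
  star_mul a b := Subtype.ext (h.star_mul a b)
  norm_star a := h.norm_star a

/-- Meant for the quotient by the kernel: definiteness of the quotient seminorm and completeness are
also pulled back along `Φ`. -/
theorem IsBanachStarAlgebra.of_isometry {A B : Type*} [SeminormedAddCommGroup A] [NormedSpace ℂ A]
    [SeminormedAddCommGroup B] [NormedSpace ℂ B] {mulA : A → A → A} {starA : A → A}
    {mulB : B → B → B} {starB : B → B} (h : IsBanachStarAlgebra mulB starB) (Φ : A ≃ₗᵢ[ℂ] B)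
    (hmul : ∀ a b, Φ (mulA a b) = mulB (Φ a) (Φ b)) (hstar : ∀ a, Φ (starA a) = starB (Φ a)) :
    IsBanachStarAlgebra mulA starA where
  eq_zero_of_norm_eq_zero a ha := by
    rw [← Φ.map_eq_zero_iff]
    exact h.eq_zero_of_norm_eq_zero _ (by rwa [Φ.norm_map])
  complete := 
    have := h.complete
    (Φ.isometry.isUniformInducing.completeSpace_congr Φ.surjective).2 h.complete
  mul_add a b c := Φ.injective (by simp only [hmul, map_add, h.mul_add])
  add_mul a b c := Φ.injective (by simp only [hmul, map_add, h.add_mul])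
  smul_mul z a b := Φ.injective (by simp only [hmul, map_smul, h.smul_mul])
  mul_smul z a b := Φ.injective (by simp only [hmul, map_smul, h.mul_smul])
  mul_assoc a b c := Φ.injective (by simp only [hmul, h.mul_assoc])
  norm_mul_le a b := by
    have := h.norm_mul_le (Φ a) (Φ b)
    rwa [← hmul, Φ.norm_map, Φ.norm_map, Φ.norm_map] at this
  star_add a b := Φ.injective (by simp only [hstar, map_add, h.star_add])
  star_smul z a := Φ.injective (by simp only [hstar, map_smul, h.star_smul])
  star_star a := Φ.injective (by simp only [hstar, h.star_star])
  star_mul a b := Φ.injective (by simp only [hstar, hmul, h.star_mul])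
  norm_star a := by rw [← Φ.norm_map, hstar, h.norm_star, Φ.norm_map]

/-! ### Covariant functions and the operator `T_ξ` -/

section Covariant

variable {G : Type*} [Group G] [TopologicalSpace G] [IsTopologicalGroup G] [CompactSpace G]
  {N : Subgroup G} {ξ : N →ₜ* Circle}

/-- The support condition is automatic on a compact group. -/
theorem mem_covariantSubmodule {ψ : C(G, ℂ)} :
    ψ ∈ covariantSubmodule N ξ ↔ ∀ (x : G) (s : N), ψ (x * s) = (ξ s : ℂ) * ψ x :=
  ⟨fun h => h.2, fun h => ⟨(isClosed_tsupport _).isCompact.image continuous_quotient_mk', h⟩⟩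

theorem conj_coe_circle (z : Circle) : (starRingEnd ℂ) (z : ℂ) = ((z⁻¹ : Circle) : ℂ) :=
  (Circle.coe_inv_eq_conj z).symm

/-- Write `s * x = x * (x⁻¹ * s * x)` and use invariance of `ξ`. -/
theorem apply_coe_mul [hN : N.Normal] (hξ : ξ ∈ invariantCharacters N) {ψ : C(G, ℂ)}
    (hψ : ψ ∈ covariantSubmodule N ξ) (s : N) (x : G) : ψ (s * x) = (ξ s : ℂ) * ψ x := by
  rw [← hξ x s, ← mem_covariantSubmodule.1 hψ]
  simp [mul_assoc]

theorem involC_mem_covariantSubmodule [hN : N.Normal] (hξ : ξ ∈ invariantCharacters N)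
    {ψ : C(G, ℂ)} (hψ : ψ ∈ covariantSubmodule N ξ) : involC ψ ∈ covariantSubmodule N ξ := by
  rw [mem_covariantSubmodule]
  intro x s
  have h := apply_coe_mul hξ hψ s⁻¹ x⁻¹
  rw [Subgroup.coe_inv, ← mul_inv_rev] at h
  rw [involC_apply, h, map_mul, map_inv, conj_coe_circle, inv_inv, involC_apply]

variable [MeasurableSpace G] [BorelSpace G] {μ : Measure G}

/-- Right translation of `f * ψ` acts on `ψ` alone, so `f` may be arbitrary. -/
theorem convC_mem_covariantSubmodule [IsProbabilityMeasure μ] [μ.IsHaarMeasure] (f : C(G, ℂ))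
    {ψ : C(G, ℂ)} (hψ : ψ ∈ covariantSubmodule N ξ) : convC μ f ψ ∈ covariantSubmodule N ξ := by
  rw [mem_covariantSubmodule] at hψ ⊢
  intro x s
  simp only [convC_apply, ← integral_const_mul, ← mul_assoc, hψ]
  simp only [mul_comm, mul_left_comm]

/-! ### The average against `ξ` over `N`, on continuous functions -/

section Average

variable [CompactSpace N] (ξ) (lN : Measure N) [lN.IsHaarMeasure] [IsProbabilityMeasure lN]

/-- The operator `T_ξ` on continuous functions. -/
def averageC (f : C(G, ℂ)) : C(G, ℂ) :=
  paramIntegral lN ⟨fun z : N × G => f (z.2 * z.1) * (starRingEnd ℂ) (ξ z.1 : ℂ), by fun_prop⟩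

theorem averageC_apply (f : C(G, ℂ)) (x : G) :
    averageC ξ lN f x = ∫ s : N, f (x * s) * (starRingEnd ℂ) (ξ s : ℂ) ∂lN :=
  paramIntegral_apply lN _ x

theorem coe_averageC (f : C(G, ℂ)) : (averageC ξ lN f : G → ℂ) = covariantAverage N ξ lN f :=
  funext (averageC_apply ξ lN f)

theorem averageC_mem (f : C(G, ℂ)) : averageC ξ lN f ∈ covariantSubmodule N ξ := by
  rw [mem_covariantSubmodule]
  intro x t
  rw [averageC_apply, averageC_apply, ← integral_const_mul, ← integral_mul_left_eq_self _ t⁻¹]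
  refine integral_congr_ae (.of_forall fun s => ?_)
  simp only [map_mul, map_inv, conj_coe_circle, Subgroup.coe_mul, Subgroup.coe_inv,
    mul_assoc, mul_inv_cancel_left, inv_inv, Circle.coe_mul]
  ring

/-- The integrand is constant in `s`, since `|ξ| = 1`, and `N` has mass 1. Thus `T_ξ` is a
projection. -/
theorem averageC_eq_self {ψ : C(G, ℂ)} (hψ : ψ ∈ covariantSubmodule N ξ) :
    averageC ξ lN ψ = ψ := by
  ext x
  rw [averageC_apply]
  rw [mem_covariantSubmodule] at hψ
  have h (s : N) : ψ (x * s) * (starRingEnd ℂ) (ξ s : ℂ) = ψ x := by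
    rw [hψ, mul_right_comm, Complex.mul_conj, Circle.normSq_coe]
    simp
  simp [h]

theorem integrable_averageC (f : C(G, ℂ)) (x : G) :
    Integrable (fun s : N => f (x * s) * (starRingEnd ℂ) (ξ s : ℂ)) lN :=
  integrable_of_continuous lN (by fun_prop)

theorem averageC_add (f g : C(G, ℂ)) :
    averageC ξ lN (f + g) = averageC ξ lN f + averageC ξ lN g := by
  ext x
  simp only [averageC_apply, ContinuousMap.add_apply, add_mul]
  exact integral_add (integrable_averageC ξ lN f x) (integrable_averageC ξ lN g x)

theorem averageC_smul (z : ℂ) (f : C(G, ℂ)) :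
    averageC ξ lN (z • f) = z • averageC ξ lN f := by
  ext x
  simp only [averageC_apply, ContinuousMap.smul_apply, smul_eq_mul, mul_assoc, integral_const_mul]

/-- The two sides average `f` over `N * x⁻¹` and over `x⁻¹ * N`. Inversion in `N` and conjugation by
`x⁻¹` match them, and `ξ` does not see the conjugation. -/
theorem averageC_involC [hN : N.Normal] (hξ : ξ ∈ invariantCharacters N) (f : C(G, ℂ)) :
    averageC ξ lN (involC f) = involC (averageC ξ lN f) := by
  have := isInvInvariant_of_isProbabilityMeasure lN
  ext x
  rw [involC_apply, averageC_apply, averageC_apply, ← integral_conj, ← integral_inv_eq_self _ lN]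
  have h := integral_conj_eq_self N lN x⁻¹
    fun s => involC f (x * (s⁻¹ : N)) * (starRingEnd ℂ) (ξ s⁻¹ : ℂ)
  rw [← h]
  refine integral_congr_ae (.of_forall fun s => ?_)
  have h' := hξ x s
  simp only [map_inv, conj_coe_circle, involC_apply, map_mul, inv_inv, Subgroup.coe_inv] at h' ⊢
  rw [h']
  simp [mul_assoc]

variable [IsProbabilityMeasure μ] [μ.IsHaarMeasure]

theorem norm_toLp_averageC_le (p : ℝ≥0∞) [Fact (1 ≤ p)] (f : C(G, ℂ)) :
    ‖ContinuousMap.toLp (E := ℂ) p μ ℂ (averageC ξ lN f)‖ ≤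
      ‖ContinuousMap.toLp (E := ℂ) p μ ℂ f‖ := by
  have := isMulRightInvariant_of_isProbabilityMeasure μ
  refine (norm_toLp_paramIntegral_le lN p μ _).trans ?_
  have h (s : N) : ‖ContinuousMap.toLp (E := ℂ) p μ ℂ (ContinuousMap.curry
      ⟨fun z : N × G => f (z.2 * z.1) * (starRingEnd ℂ) (ξ z.1 : ℂ), by fun_prop⟩ s)‖ =
      1 * ‖ContinuousMap.toLp (E := ℂ) p μ ℂ f‖ :=
    norm_toLp_eq_of_measurePreserving p μ (measurePreserving_mul_right μ (s : G)) zero_le_one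
      fun x => by
        simp only [ContinuousMap.curry_apply, ContinuousMap.coe_mk, norm_mul, RCLike.norm_conj,
          one_mul]
        rw [Circle.norm_coe, mul_one]
  simp [h]

theorem averageC_convC (f g : C(G, ℂ)) :
    averageC ξ lN (convC μ f g) = convC μ f (averageC ξ lN g) := by
  ext x
  simp only [convC_apply, averageC_apply, ← integral_mul_const, ← integral_const_mul]
  rw [integral_swap_of_continuous lN μ (by fun_prop)]
  simp only [mul_assoc]

/-- Right translation by `s` in the `y` integral moves `s` to the left of the argument of `ψ`, where
left covariance produces `ξ s` and cancels the conjugate. With `averageC_convC` this yields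
multiplicativity of `T_ξ`. -/
theorem convC_averageC [hN : N.Normal] (hξ : ξ ∈ invariantCharacters N) (f : C(G, ℂ))
    {ψ : C(G, ℂ)} (hψ : ψ ∈ covariantSubmodule N ξ) :
    convC μ (averageC ξ lN f) ψ = convC μ f ψ := by
  have := isMulRightInvariant_of_isProbabilityMeasure μ
  ext x
  simp only [convC_apply, averageC_apply, ← integral_mul_const]
  rw [integral_swap_of_continuous μ lN (by fun_prop)]
  have h (s : N) : ∫ y, f (y * s) * (starRingEnd ℂ) (ξ s : ℂ) * ψ (y⁻¹ * x) ∂μ =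
      ∫ y, f y * ψ (y⁻¹ * x) ∂μ := by
    rw [← integral_mul_right_eq_self (μ := μ) (fun y => f y * ψ (y⁻¹ * x)) (s : G)]
    refine integral_congr_ae (.of_forall fun y => ?_)
    have hy := apply_coe_mul hξ hψ s⁻¹ (y⁻¹ * x)
    rw [Subgroup.coe_inv, ← mul_assoc, ← mul_inv_rev, map_inv, ← conj_coe_circle] at hy
    simp only [hy, mul_assoc]
  simp [h]

end Average

end Covariant

/-! ### The norm of `L^p_ξ(G,N)` and the extension of `T_ξ` -/

section CovariantLp

variable {G : Type*} [Group G] [TopologicalSpace G] [IsTopologicalGroup G] [CompactSpace G]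
  [MeasurableSpace G] [BorelSpace G] {N : Subgroup G} {ξ : N →ₜ* Circle} {p : ℝ≥0∞}
  [hp1 : Fact (1 ≤ p)] {μ : Measure G} [IsProbabilityMeasure μ]

/-- Weil's formula for `|ψ|^p`, which is constant on the cosets of `N` and so equals its own average
over `N`. -/
theorem covariantNorm_eq (hp : p ≠ ∞) (lN : Measure N) [lN.IsHaarMeasure] [IsProbabilityMeasure lN]
    [MeasurableSpace (G ⧸ N)] (ν : Measure (G ⧸ N)) (hν : WeilFormula N μ lN ν)
    (ψ : covariantSubmodule N ξ) :
    covariantNorm N ξ ν p.toReal ψ = ‖ContinuousMap.toLp (E := ℂ) p μ ℂ (ψ : C(G, ℂ))‖ := by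
  have hp0 : p ≠ 0 := (zero_lt_one.trans_le hp1.out).ne'
  have hpr : 0 ≤ p.toReal := ENNReal.toReal_nonneg
  let F : C(G, ℂ) := ⟨fun x => ((‖(ψ : C(G, ℂ)) x‖ ^ p.toReal : ℝ) : ℂ),
    Complex.continuous_ofReal.comp ((ψ : C(G, ℂ)).continuous.norm.rpow_const fun _ => .inr hpr)⟩
  have hF : averageQuot N lN F = fun z => ((absPowQuot N ξ p.toReal ψ z : ℝ) : ℂ) := by
    funext z
    induction z using QuotientGroup.induction_on with
    | H x =>
      have h : ∀ s : N, F (x * s) = F x := fun s => by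
        simp only [F, ContinuousMap.coe_mk, ψ.2.2 x s, norm_mul, Circle.norm_coe, one_mul]
      change ∫ s : N, F (x * s) ∂lN = F x
      simp [h]
  have h := hν F
  rw [hF, integral_complex_ofReal] at h
  simp only [F, ContinuousMap.coe_mk] at h
  rw [integral_complex_ofReal, Complex.ofReal_inj] at h
  have hm : MemLp (ψ : C(G, ℂ)) p μ :=
    (memLp_congr_ae (ContinuousMap.coeFn_toLp (𝕜 := ℂ) μ _)).1 (Lp.memLp _)
  rw [covariantNorm, h, Lp.norm_def, eLpNorm_congr_ae (ContinuousMap.coeFn_toLp (𝕜 := ℂ) μ _),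
    hm.eLpNorm_eq_integral_rpow_norm hp0 hp, ENNReal.toReal_ofReal (by positivity), one_div]

theorem toLp_mem_covariantLp {ψ : C(G, ℂ)} (hψ : ψ ∈ covariantSubmodule N ξ) :
    ContinuousMap.toLp (E := ℂ) p μ ℂ ψ ∈ covariantLp N ξ p μ :=
  Submodule.le_topologicalClosure _ ⟨ψ, hψ, rfl⟩

theorem isClosed_covariantLp : IsClosed (covariantLp N ξ p μ : Set (Lp ℂ p μ)) :=
  Submodule.isClosed_topologicalClosure _

theorem covariantLp_induction {P : Lp ℂ p μ → Prop} (hP : IsClosed {f | P f})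
    (h : ∀ ψ ∈ covariantSubmodule N ξ, P (ContinuousMap.toLp (E := ℂ) p μ ℂ ψ))
    {f : Lp ℂ p μ} (hf : f ∈ covariantLp N ξ p μ) : P f := by
  refine closure_minimal ?_ hP hf
  rintro _ ⟨ψ, hψ, rfl⟩
  exact h ψ hψ

variable [μ.IsHaarMeasure]

theorem involLp_mem_covariantLp [N.Normal] (hξ : ξ ∈ invariantCharacters N) {f : Lp ℂ p μ}
    (hf : f ∈ covariantLp N ξ p μ) : involLp f ∈ covariantLp N ξ p μ :=
  covariantLp_induction (isClosed_covariantLp.preimage continuous_involLp)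
    (fun ψ hψ => by
      change involLp _ ∈ covariantLp N ξ p μ
      rw [involLp_toLp]
      exact toLp_mem_covariantLp (involC_mem_covariantSubmodule hξ hψ)) hf

variable [T2Space G]

theorem convLp_mem_covariantLp (hp : p ≠ ∞) (f : Lp ℂ p μ) {g : Lp ℂ p μ}
    (hg : g ∈ covariantLp N ξ p μ) : convLp f g ∈ covariantLp N ξ p μ := by
  have hc := continuous_convLp (μ := μ) hp
  -- Closedness reduces `g` to a continuous covariant function, then density reduces `f` to a
  -- continuous one.
  refine covariantLp_induction (isClosed_covariantLp.preimage
    (hc.comp₂ continuous_const continuous_id)) (fun ψ hψ => ?_) hg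
  refine (toLp_dense hp).induction_on (p := fun f => convLp f
    (ContinuousMap.toLp (E := ℂ) p μ ℂ ψ) ∈ covariantLp N ξ p μ) f
    (isClosed_covariantLp.preimage (hc.comp₂ continuous_id continuous_const)) fun f => ?_
  rw [convLp_toLp]
  exact toLp_mem_covariantLp (convC_mem_covariantSubmodule f hψ)

variable [CompactSpace N] (ξ) (p) (μ) (lN : Measure N) [lN.IsHaarMeasure] [IsProbabilityMeasure lN]

/-- `T_ξ : 𝒞(G) → L^p_ξ(G,N)` as a linear map. -/
def averageLinear : C(G, ℂ) →ₗ[ℂ] covariantLp N ξ p μ where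
  toFun f := ⟨ContinuousMap.toLp (E := ℂ) p μ ℂ (averageC ξ lN f),
    toLp_mem_covariantLp (averageC_mem ξ lN f)⟩
  map_add' f g := Subtype.ext (by simp [averageC_add])
  map_smul' z f := Subtype.ext (by simp [averageC_smul])

/-- The continuous extension of `T_ξ` to `L^p(G)`. -/
def averageLp : Lp ℂ p μ →L[ℂ] covariantLp N ξ p μ :=
  have : CompleteSpace (covariantLp N ξ p μ) := isClosed_covariantLp.completeSpace_coe
  (averageLinear ξ p μ lN).extendOfNorm (ContinuousMap.toLp (E := ℂ) p μ ℂ).toLinearMap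

variable {p}

theorem averageLp_toLp (hp : p ≠ ∞) (f : C(G, ℂ)) :
    (averageLp ξ p μ lN (ContinuousMap.toLp (E := ℂ) p μ ℂ f) : Lp ℂ p μ) =
      ContinuousMap.toLp (E := ℂ) p μ ℂ (averageC ξ lN f) := by
  have : CompleteSpace (covariantLp N ξ p μ) := isClosed_covariantLp.completeSpace_coe
  exact congrArg Subtype.val (LinearMap.extendOfNorm_eq (f := averageLinear ξ p μ lN)
    (e := (ContinuousMap.toLp (E := ℂ) p μ ℂ).toLinearMap) (toLp_dense hp)
    ⟨1, fun f => by simpa using! norm_toLp_averageC_le ξ lN p f⟩ f)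

theorem norm_averageLp_le (hp : p ≠ ∞) (f : Lp ℂ p μ) : ‖averageLp ξ p μ lN f‖ ≤ ‖f‖ := by
  refine (toLp_dense hp).induction_on (p := fun f => ‖averageLp ξ p μ lN f‖ ≤ ‖f‖) f
    (isClosed_le (by fun_prop) (by fun_prop)) fun f => ?_
  rw [← Submodule.norm_coe, averageLp_toLp ξ μ lN hp]
  exact norm_toLp_averageC_le ξ lN p f

theorem extendsCovariantAverage_averageLp (hp : p ≠ ∞) :
    ExtendsCovariantAverage N ξ p μ lN (averageLp ξ p μ lN) := fun f =>
  ⟨averageC ξ lN f, averageC_mem ξ lN f, coe_averageC ξ lN f, averageLp_toLp ξ μ lN hp f⟩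

theorem ExtendsCovariantAverage.unique (hp : p ≠ ∞) {T T' : Lp ℂ p μ →L[ℂ] covariantLp N ξ p μ}
    (hT : ExtendsCovariantAverage N ξ p μ lN T) (hT' : ExtendsCovariantAverage N ξ p μ lN T') :
    T' = T := by
  refine ContinuousLinearMap.coeFn_injective
    ((toLp_dense hp).equalizer T'.continuous T.continuous (funext fun f => Subtype.ext ?_))
  obtain ⟨ψ, -, h1, h2⟩ := hT f
  obtain ⟨ψ', -, h1', h2'⟩ := hT' f
  obtain rfl : ψ' = ψ := DFunLike.coe_injective (h1'.trans h1.symm)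
  exact h2'.trans h2.symm

theorem averageLp_eq_self (hp : p ≠ ∞) {f : Lp ℂ p μ} (hf : f ∈ covariantLp N ξ p μ) :
    (averageLp ξ p μ lN f : Lp ℂ p μ) = f :=
  covariantLp_induction (P := fun f => (averageLp ξ p μ lN f : Lp ℂ p μ) = f)
    (isClosed_eq (by fun_prop) continuous_id)
    (fun ψ hψ => by rw [averageLp_toLp ξ μ lN hp, averageC_eq_self ξ lN hψ]) hf

theorem averageLp_involLp [N.Normal] (hp : p ≠ ∞) (hξ : ξ ∈ invariantCharacters N)
    (f : Lp ℂ p μ) :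
    (averageLp ξ p μ lN (involLp f) : Lp ℂ p μ) = involLp (averageLp ξ p μ lN f : Lp ℂ p μ) := by
  have hi := continuous_involLp (μ := μ) (p := p)
  have hT : Continuous fun f => (averageLp ξ p μ lN f : Lp ℂ p μ) := by fun_prop
  refine (toLp_dense hp).induction_on (p := fun f => (averageLp ξ p μ lN (involLp f) : Lp ℂ p μ) =
    involLp (averageLp ξ p μ lN f : Lp ℂ p μ)) f
    (isClosed_eq (hT.comp hi) (hi.comp hT)) fun f => ?_
  rw [involLp_toLp, averageLp_toLp ξ μ lN hp, averageLp_toLp ξ μ lN hp, averageC_involC ξ lN hξ,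
    involLp_toLp]

theorem averageLp_convLp [N.Normal] (hp : p ≠ ∞) (hξ : ξ ∈ invariantCharacters N)
    (f g : Lp ℂ p μ) : (averageLp ξ p μ lN (convLp f g) : Lp ℂ p μ) =
      convLp (averageLp ξ p μ lN f : Lp ℂ p μ) (averageLp ξ p μ lN g : Lp ℂ p μ) := by
  have hc := continuous_convLp (μ := μ) hp
  have hT : Continuous fun f => (averageLp ξ p μ lN f : Lp ℂ p μ) := by fun_prop
  refine (toLp_dense (μ := μ) hp).induction_on₂ (p := fun f g =>
    (averageLp ξ p μ lN (convLp f g) : Lp ℂ p μ) =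
      convLp (averageLp ξ p μ lN f : Lp ℂ p μ) (averageLp ξ p μ lN g : Lp ℂ p μ))
    (isClosed_eq (hT.comp hc) (hc.comp₂ (hT.comp continuous_fst) (hT.comp continuous_snd)))
    (fun f g => ?_) f g
  rw [convLp_toLp, averageLp_toLp ξ μ lN hp, averageLp_toLp ξ μ lN hp, averageLp_toLp ξ μ lN hp,
    convLp_toLp, convC_averageC ξ lN hξ f (averageC_mem ξ lN g), averageC_convC]

end CovariantLp

/-! ### The quotient by the kernel of a contractive projection, and the theorem -/

theorem exists_quotient_ker_isometry {A : Type*} [NormedAddCommGroup A] [NormedSpace ℂ A]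
    (S : Submodule ℂ A) (T : A →L[ℂ] S) (hT : ∀ a, ‖T a‖ ≤ ‖a‖) (hS : ∀ a : S, T a = a) :
    ∃ Φ : (A ⧸ LinearMap.ker T.toLinearMap) ≃ₗᵢ[ℂ] S,
      ∀ a : A, Φ (Submodule.Quotient.mk a) = T a := by
  let Φ := T.toLinearMap.quotKerEquivOfSurjective fun a => ⟨a, hS a⟩
  have hΦ : ∀ a : A, Φ (Submodule.Quotient.mk a) = T a := fun a => rfl
  refine ⟨⟨Φ, fun q => ?_⟩, hΦ⟩
  apply le_antisymm
  · refine le_of_forall_pos_le_add fun ε hε => ?_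
    -- Contractivity on almost optimal representatives bounds `‖Φ q‖` by the quotient norm.
    obtain ⟨a, rfl, ha⟩ := Submodule.Quotient.norm_mk_lt q hε
    rw [hΦ]
    exact (hT a).trans ha.le
  · obtain ⟨a, rfl⟩ := Submodule.Quotient.mk_surjective _ q
    -- As `T` is a projection, `T a` represents the class of `a`, which gives the reverse bound.
    have h : (Submodule.Quotient.mk a : A ⧸ LinearMap.ker T.toLinearMap) =
        Submodule.Quotient.mk (T a : A) := Φ.injective (by rw [hΦ, hΦ, hS])
    rw [hΦ, h]
    exact Submodule.Quotient.norm_mk_le _ _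

end CovariantLp

end

theorem mainTheorem9 {G : Type*} [Group G] [TopologicalSpace G] [IsTopologicalGroup G]
    [CompactSpace G] [T2Space G] [MeasurableSpace G] [BorelSpace G]
    -- the normalized Haar measure of `G`
    (μ : Measure G) [μ.IsHaarMeasure] [μ.Regular] [IsProbabilityMeasure μ]
    (N : Subgroup G) [N.Normal] (_hN : IsClosed (N : Set G))
    -- the normalized Haar measure of `N`
    (lN : Measure N) [lN.IsHaarMeasure] [lN.Regular] [IsProbabilityMeasure lN]
    -- the Haar measure of `G/N`, normalized by Weil's formula
    [MeasurableSpace (G ⧸ N)] [BorelSpace (G ⧸ N)]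
    (ν : Measure (G ⧸ N)) [ν.IsHaarMeasure] [ν.Regular]
    (_hν : CovariantLp.WeilFormula N μ lN ν)
    (ξ : N →ₜ* Circle) (_hξ : ξ ∈ CovariantLp.invariantCharacters N)
    (p : ℝ≥0∞) [Fact (1 ≤ p)] (_hp1 : 1 < p) (_hp : p ≠ ∞) :
    -- convolution and involution are well defined on `L^p(G)`
    (∀ f g : Lp ℂ p μ, (∀ᵐ x ∂μ, Integrable (fun y => f y * g (y⁻¹ * x)) μ) ∧
      MemLp (CovariantLp.conv μ f g) p μ) ∧
    (∀ f : Lp ℂ p μ, MemLp (CovariantLp.invol f) p μ) ∧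
    -- on `𝒞_ξ(G,N)`, the norm of `L^p_ξ(G,N)` is the norm of `L^p(G)`
    (∀ ψ : CovariantLp.covariantSubmodule N ξ, CovariantLp.covariantNorm N ξ ν p.toReal ψ =
      ‖ContinuousMap.toLp (E := ℂ) p μ ℂ (ψ : C(G, ℂ))‖) ∧
    -- `L^p(G)` is a Banach `*`-algebra
    CovariantLp.IsBanachStarAlgebra (A := Lp ℂ p μ) CovariantLp.convLp CovariantLp.involLp ∧
    -- `L^p_ξ(G,N)` is stable under convolution and involution
    ∃ (hmul : ∀ a b : CovariantLp.covariantLp N ξ p μ,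
        CovariantLp.convLp (a : Lp ℂ p μ) b ∈ CovariantLp.covariantLp N ξ p μ)
      (hstar : ∀ a : CovariantLp.covariantLp N ξ p μ,
        CovariantLp.involLp (a : Lp ℂ p μ) ∈ CovariantLp.covariantLp N ξ p μ),
      -- and is a Banach `*`-algebra
      CovariantLp.IsBanachStarAlgebra (A := CovariantLp.covariantLp N ξ p μ)
        (fun a b => ⟨CovariantLp.convLp (a : Lp ℂ p μ) b, hmul a b⟩)
        (fun a => ⟨CovariantLp.involLp (a : Lp ℂ p μ), hstar a⟩) ∧
      -- the operator `T_ξ : L^p(G) → L^p_ξ(G,N)`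
      ∃ T : Lp ℂ p μ →L[ℂ] CovariantLp.covariantLp N ξ p μ,
        CovariantLp.ExtendsCovariantAverage N ξ p μ lN T ∧
        (∀ T' : Lp ℂ p μ →L[ℂ] CovariantLp.covariantLp N ξ p μ,
          CovariantLp.ExtendsCovariantAverage N ξ p μ lN T' → T' = T) ∧
        -- is a contraction and a `*`-homomorphism
        (∀ f, ‖T f‖ ≤ ‖f‖) ∧
        (∀ f g, T (CovariantLp.convLp f g) =
          ⟨CovariantLp.convLp (T f : Lp ℂ p μ) (T g), hmul (T f) (T g)⟩) ∧
        (∀ f, T (CovariantLp.involLp f) =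
          ⟨CovariantLp.involLp (T f : Lp ℂ p μ), hstar (T f)⟩) ∧
        -- its kernel is a closed `*`-ideal
        CovariantLp.IsClosedStarIdeal (A := Lp ℂ p μ) CovariantLp.convLp CovariantLp.involLp
          (LinearMap.ker T.toLinearMap) ∧
        -- the quotient by the kernel, with the quotient norm and the induced operations,
        -- is a Banach `*`-algebra
        ∃ (mulQ : (Lp ℂ p μ ⧸ LinearMap.ker T.toLinearMap) →
              (Lp ℂ p μ ⧸ LinearMap.ker T.toLinearMap) →
              (Lp ℂ p μ ⧸ LinearMap.ker T.toLinearMap))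
          (starQ : (Lp ℂ p μ ⧸ LinearMap.ker T.toLinearMap) →
              (Lp ℂ p μ ⧸ LinearMap.ker T.toLinearMap)),
          (∀ f g : Lp ℂ p μ, mulQ (Submodule.Quotient.mk f) (Submodule.Quotient.mk g) =
            Submodule.Quotient.mk (CovariantLp.convLp f g)) ∧
          (∀ f : Lp ℂ p μ, starQ (Submodule.Quotient.mk f) =
            Submodule.Quotient.mk (CovariantLp.involLp f)) ∧
          CovariantLp.IsBanachStarAlgebra mulQ starQ ∧
          -- which `T_ξ` identifies isometrically with `L^p_ξ(G,N)`
          ∃ Φ : (Lp ℂ p μ ⧸ LinearMap.ker T.toLinearMap) ≃ₗᵢ[ℂ] CovariantLp.covariantLp N ξ p μ,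
            (∀ f : Lp ℂ p μ, Φ (Submodule.Quotient.mk f) = T f) ∧
            (∀ a b, Φ (mulQ a b) = ⟨CovariantLp.convLp (Φ a : Lp ℂ p μ) (Φ b),
              hmul (Φ a) (Φ b)⟩) ∧
            (∀ a, Φ (starQ a) = ⟨CovariantLp.involLp (Φ a : Lp ℂ p μ), hstar (Φ a)⟩) := by
  have hNc : CompactSpace N := isCompact_iff_compactSpace.1 _hN.isCompact
  have hmul (a b : CovariantLp.covariantLp N ξ p μ) :
      CovariantLp.convLp (a : Lp ℂ p μ) b ∈ CovariantLp.covariantLp N ξ p μ :=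
    CovariantLp.convLp_mem_covariantLp (N := N) (ξ := ξ) _hp (a : Lp ℂ p μ) (g := (b : Lp ℂ p μ)) b.2
  have hstar (a : CovariantLp.covariantLp N ξ p μ) :
      CovariantLp.involLp (a : Lp ℂ p μ) ∈ CovariantLp.covariantLp N ξ p μ :=
    CovariantLp.involLp_mem_covariantLp _hξ (f := (a : Lp ℂ p μ)) a.2
  have hL := CovariantLp.isBanachStarAlgebra_Lp (μ := μ) _hp
  have hLξ := hL.submodule _ CovariantLp.isClosed_covariantLp hmul hstar
  let T := CovariantLp.averageLp ξ p μ lN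
  have hTmul (f g : Lp ℂ p μ) : T (CovariantLp.convLp f g) =
      ⟨CovariantLp.convLp (T f : Lp ℂ p μ) (T g), hmul (T f) (T g)⟩ :=
    Subtype.ext (CovariantLp.averageLp_convLp ξ μ lN _hp _hξ f g)
  have hTstar (f : Lp ℂ p μ) : T (CovariantLp.involLp f) =
      ⟨CovariantLp.involLp (T f : Lp ℂ p μ), hstar (T f)⟩ :=
    Subtype.ext (CovariantLp.averageLp_involLp ξ μ lN _hp _hξ f)
  have hTle := CovariantLp.norm_averageLp_le ξ μ lN _hp
  have hText := CovariantLp.extendsCovariantAverage_averageLp ξ μ lN _hp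
  obtain ⟨Φ, hΦ⟩ := CovariantLp.exists_quotient_ker_isometry _ T hTle fun a =>
    Subtype.ext (CovariantLp.averageLp_eq_self ξ μ lN _hp a.2)
  refine ⟨fun f g => ⟨CovariantLp.ae_integrable_conv _hp f g, CovariantLp.memLp_conv _hp f g⟩,
    fun f => CovariantLp.memLp_invol (Lp.memLp f), CovariantLp.covariantNorm_eq _hp lN ν _hν, hL,
    hmul, hstar, hLξ, T, hText, fun T' hT' => hText.unique ξ μ lN _hp hT', hTle, hTmul, hTstar,
    ⟨T.isClosed_ker, fun a b hb => ?_, fun a b ha => ?_, fun a ha => ?_⟩,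
    -- The operations on the quotient are transported along `Φ`; that they are the induced ones is
    -- the homomorphism property of `T`.
    fun a b => Φ.symm ⟨CovariantLp.convLp (Φ a : Lp ℂ p μ) (Φ b), hmul _ _⟩,
    fun a => Φ.symm ⟨CovariantLp.involLp (Φ a : Lp ℂ p μ), hstar _⟩,
    fun f g => ?_, fun f => ?_, ?_, Φ, hΦ, fun a b => ?_, fun a => ?_⟩
  · rw [LinearMap.mem_ker, ContinuousLinearMap.coe_coe] at hb ⊢
    rw [hTmul, hb, ← norm_le_zero_iff]
    -- A product with zero vanishes by submultiplicativity of the norm.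
    simpa using hL.norm_mul_le (T a : Lp ℂ p μ) 0
  · rw [LinearMap.mem_ker, ContinuousLinearMap.coe_coe] at ha ⊢
    rw [hTmul, ha, ← norm_le_zero_iff]
    simpa using hL.norm_mul_le 0 (T b : Lp ℂ p μ)
  · rw [LinearMap.mem_ker, ContinuousLinearMap.coe_coe] at ha ⊢
    rw [hTstar, ha, ← norm_eq_zero]
    simpa using hL.norm_star 0
  · rw [LinearIsometryEquiv.symm_apply_eq]
    simp only [hΦ, hTmul]
  · rw [LinearIsometryEquiv.symm_apply_eq]
    simp only [hΦ, hTstar]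
  · exact hLξ.of_isometry Φ (fun a b => Φ.apply_symm_apply _) fun a => Φ.apply_symm_apply _
  · rw [LinearIsometryEquiv.apply_symm_apply]
  · rw [LinearIsometryEquiv.apply_symm_apply]
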